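/- Let $A$ be a finite alphabet and $\ell\in\mathbb N$. Consider monadic second-order (MSO) formulae over $A$ with monadic predicate symbols $P_1,\dots,P_\ell$, generated by the grammar $$\varphi ::= a(x)\mid x\le y\mid P_i(x)\mid x\in X\mid \varphi\wedge\varphi\mid\neg\varphi\mid\exists x\,\varphi\mid\exists X\,\varphi\qquad(a\in A,\ 1\le i\le\ell),$$ and interpreted over infinite words $w=w_0w_1w_2\cdots\in A^\omega$: first-order variables $x,y$ range over positions in $\mathbb N$, second-order variables $X$ over arbitrary sets of positions, $a(x)$ means that $w_x=a$, and $P_i$ is interpreted by a uniform monadic predicate, i.e. a set $\mathbf P_i\subseteq\mathbb N$ of positions that does not depend on $w$. For a sentence $\varphi$ (a formula without free variables) and a tuple $\overline{\mathbf P}=(\mathbf P_1,\dots,\mathbf P_\ell)$ of uniform monadic predicates put $L_{\varphi,\overline{\mathbf P}}=\{w\in A^\omega\mid w,\overline{\mathbf P}\models\varphi\}$. A language $L\subseteq A^\omega$ is called $\omega$-regular if it is recognized by a finite nondeterministic Büchi automaton. A uniform monadic predicate $\mathbf Q\subseteq\mathbb N$ is called regular if the language over $\{0,1\}$ that contains,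 for each $n\in\mathbb N$, exactly one word of length $n$, namely the characteristic word of $\mathbf Q\cap\{0,\dots,n-1\}$, is a regular language of finite words. **Theorem.** For every sentence $\varphi$ and every tuple $\overline{\mathbf P}$ of uniform monadic predicates such that $L_{\varphi,\overline{\mathbf P}}$ is $\omega$-regular, there is a tuple $\overline{\mathbf Q}=(\mathbf Q_1,\dots,\mathbf Q_\ell)$ of regular uniform monadic predicates such that $L_{\varphi,\overline{\mathbf P}}=L_{\varphi,\overline{\mathbf Q}}$. -/

import Mathlib

/-! Infinite words over `A` are functions `ℕ → A`; their positions are the natural numbers, and a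
uniform monadic predicate is a set `P : Set ℕ` of positions. -/

/-- Monadic second-order formulae over the alphabet `A`, with predicate symbols `P_0, …, P_{ℓ-1}`,
whose free first-order variables are among `x_0, …, x_{p-1}` and whose free second-order variables
are among `X_0, …, X_{q-1}`. Bound variables are de Bruijn indices: under a quantifier the newly
bound variable has index `0` and the other variables of its sort are shifted by one. -/
inductive MSOFormula (A : Type*) (ℓ : ℕ) : ℕ → ℕ → Type _
  /-- `a(x)`: the letter at position `x` is `a`. -/
  | letter {p q : ℕ} (a : A) (x : Fin p) : MSOFormula A ℓ p q
  /-- `x ≤ y`. -/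
  | le {p q : ℕ} (x y : Fin p) : MSOFormula A ℓ p q
  /-- `P_i(x)`: the position `x` belongs to the `i`-th numerical predicate. -/
  | pred {p q : ℕ} (i : Fin ℓ) (x : Fin p) : MSOFormula A ℓ p q
  /-- `x ∈ X`. -/
  | mem {p q : ℕ} (x : Fin p) (X : Fin q) : MSOFormula A ℓ p q
  | and {p q : ℕ} (φ ψ : MSOFormula A ℓ p q) : MSOFormula A ℓ p q
  | not {p q : ℕ} (φ : MSOFormula A ℓ p q) : MSOFormula A ℓ p q
  /-- First-order quantification `∃ x, φ`. -/
  | exFO {p q : ℕ} (φ : MSOFormula A ℓ (p + 1) q) : MSOFormula A ℓ p q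
  /-- Monadic second-order quantification `∃ X, φ`. -/
  | exSO {p q : ℕ} (φ : MSOFormula A ℓ p (q + 1)) : MSOFormula A ℓ p q

/-- A sentence is a formula without free variables. -/
abbrev MSOSentence (A : Type*) (ℓ : ℕ) := MSOFormula A ℓ 0 0

/-- `φ.Holds w P x X` is the satisfaction relation `w, P, x, X ⊨ φ` over the infinite word `w`,
with the predicate symbols interpreted by the uniform monadic predicates `P` and the free variables
by the positions `x` and the sets of positions `X`. -/
def MSOFormula.Holds {A : Type*} {ℓ : ℕ} (w : ℕ → A) (P : Fin ℓ → Set ℕ) :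
    {p q : ℕ} → MSOFormula A ℓ p q → (Fin p → ℕ) → (Fin q → Set ℕ) → Prop
  | _, _, .letter a x, xs, _ => w (xs x) = a
  | _, _, .le x y, xs, _ => xs x ≤ xs y
  | _, _, .pred i x, xs, _ => xs x ∈ P i
  | _, _, .mem x X, xs, Xs => xs x ∈ Xs X
  | _, _, .and φ ψ, xs, Xs => φ.Holds w P xs Xs ∧ ψ.Holds w P xs Xs
  | _, _, .not φ, xs, Xs => ¬ φ.Holds w P xs Xs
  | _, _, .exFO φ, xs, Xs => ∃ n : ℕ, φ.Holds w P (Fin.cons n xs) Xs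
  | _, _, .exSO φ, xs, Xs => ∃ S : Set ℕ, φ.Holds w P xs (Fin.cons S Xs)

/-- The language `L_{φ,P}` of the infinite words that satisfy the sentence `φ` with the predicates
`P`. -/
def MSOSentence.omegaLanguage {A : Type*} {ℓ : ℕ} (φ : MSOSentence A ℓ) (P : Fin ℓ → Set ℕ) :
    Set (ℕ → A) :=
  {w | MSOFormula.Holds w P φ Fin.elim0 Fin.elim0}

/-- The infinite words accepted by a nondeterministic automaton with the Büchi condition: some run
on the word from a start state visits accepting states infinitely often. -/
def NFA.buchiAccepts {A σ : Type*} (M : NFA A σ) : Set (ℕ → A) :=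
  {w | ∃ ρ : ℕ → σ, ρ 0 ∈ M.start ∧ (∀ i, ρ (i + 1) ∈ M.step (ρ i) (w i)) ∧
    {i | ρ i ∈ M.accept}.Infinite}

/-- A language of infinite words is `ω`-regular if a finite Büchi automaton recognizes it. -/
def IsOmegaRegular {A : Type*} (L : Set (ℕ → A)) : Prop :=
  ∃ (σ : Type) (_ : Finite σ) (M : NFA A σ), M.buchiAccepts = L

/-- A (numerical, not necessarily uniform) monadic predicate: for every length `n` a set of
positions among `0, …, n - 1`. -/
def MonadicPredicate : Type := (n : ℕ) → Set (Fin n)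

/-- A monadic predicate, read as the language of the words over `{0, 1}` (one for each length `n`)
that are the characteristic words of its `n`-th components. -/
def MonadicPredicate.language (P : MonadicPredicate) : Language Bool :=
  {u : List Bool | ∀ i : Fin u.length, u.get i = true ↔ i ∈ P u.length}

/-- A monadic predicate is regular if it is a regular language over `{0, 1}`. -/
def MonadicPredicate.IsRegular (P : MonadicPredicate) : Prop :=
  P.language.IsRegular

/-- The monadic predicate given by a uniform one: `P_n = P ∩ {0, …, n - 1}`. -/
def MonadicPredicate.ofUniform (P : Set ℕ) : MonadicPredicate :=
  fun _ => {i | (i : ℕ) ∈ P}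

/-! Read a tuple of predicates as an infinite word over the truth vectors of length `ℓ`. The tuples
`Q` that define the same language as `P` form a recognizable set: the complement of the projection,
along the input word, of the symmetric difference of an ω-regular condition and an MSO-definable
one. This set contains `P`, so by a Ramsey argument it contains an ultimately periodic word, whose
components are regular predicates. Saturating colourings suffice for this: complementation is free
by symmetry, projection takes a power set, and the Ramsey argument needs no multiplicativity of the
colouring. -/

/-- A set of infinite words is recognizable if some finite colouring `h n u` of the finite words
`u 0, …, u (n - 1)` saturates it: whenever two infinite words have factorizations into nonempty
factors with the same sequence of colours, they both belong to the set or both do not. -/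
def Recognizable {Γ : Type*} (L : Set (ℕ → Γ)) : Prop :=
  ∃ (S : Type) (_ : Finite S) (h : ℕ → (ℕ → Γ) → S),
    (∀ n u v, (∀ k < n, u k = v k) → h n u = h n v) ∧
    ∀ f g : ℕ → ℕ, StrictMono f → StrictMono g → f 0 = 0 → g 0 = 0 → ∀ u v : ℕ → Γ,
      (∀ i, h (f (i + 1) - f i) (fun k => u (f i + k)) =
        h (g (i + 1) - g i) (fun k => v (g i + k))) → u ∈ L → v ∈ L

/-! ### Factorizations of infinite words -/

/-- Every position lies in a factor. -/
theorem StrictMono.exists_factor {f : ℕ → ℕ} (hf : StrictMono f) (h0 : f 0 = 0) (m : ℕ) :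
    ∃ i k, k < f (i + 1) - f i ∧ m = f i + k := by
  have hex : ∃ i, m < f (i + 1) := ⟨m, hf.id_le (m + 1)⟩
  refine ⟨Nat.find hex, m - f (Nat.find hex), ?_⟩
  have h1 := Nat.find_spec hex
  have h2 : f (Nat.find hex) ≤ m := by
    rcases hn : Nat.find hex with _ | j
    · omega
    · exact not_lt.1 (Nat.find_min hex (m := j) (by omega))
  omega

/-- The factor of a position is unique. -/
theorem StrictMono.factor_unique {f : ℕ → ℕ} (hf : StrictMono f) {i j k l : ℕ}
    (hk : k < f (i + 1) - f i) (hl : l < f (j + 1) - f j) (h : f i + k = f j + l) : i = j := by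
  rcases lt_trichotomy i j with hij | hij | hij
  · have := hf.monotone (show i + 1 ≤ j from hij)
    omega
  · exact hij
  · have := hf.monotone (show j + 1 ≤ i from hij)
    omega

/-- Infinite words can be glued together from their factors. -/
theorem StrictMono.exists_glue {B : Type*} {f : ℕ → ℕ} (hf : StrictMono f) (h0 : f 0 = 0)
    (b : ℕ → ℕ → B) : ∃ c : ℕ → B, ∀ i, ∀ k < f (i + 1) - f i, c (f i + k) = b i k := by
  choose I K hK hm using hf.exists_factor h0
  refine ⟨fun m => b (I m) (K m), fun i k hk => ?_⟩
  have h1 := hm (f i + k)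
  have h2 : i = I (f i + k) := hf.factor_unique hk (hK _) h1
  have h3 : k = K (f i + k) := by
    rw [← h2] at h1
    omega
  dsimp only
  rw [← h2, ← h3]

/-! ### Closure properties of recognizable sets -/

namespace Recognizable

/-- Saturation is symmetric in the two words, so the same colouring works; this replaces
complementation of Büchi automata. -/
theorem compl {Γ : Type*} {L : Set (ℕ → Γ)} (hL : Recognizable L) : Recognizable Lᶜ := by
  obtain ⟨S, hS, h, hloc, hsat⟩ := hL
  exact ⟨S, hS, h, hloc, fun f g hf hg f0 g0 u v huv hu hv =>
    hu (hsat g f hg hf g0 f0 v u (fun i => (huv i).symm) hv)⟩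

theorem inter {Γ : Type*} {L M : Set (ℕ → Γ)} (hL : Recognizable L) (hM : Recognizable M) :
    Recognizable (L ∩ M) := by
  obtain ⟨S, hS, h, hloc, hsat⟩ := hL
  obtain ⟨T, hT, k, kloc, ksat⟩ := hM
  refine ⟨S × T, inferInstance, fun n u => (h n u, k n u), fun n u v huv => ?_,
    fun f g hf hg f0 g0 u v huv hu => ⟨?_, ?_⟩⟩
  · exact Prod.ext (hloc n u v huv) (kloc n u v huv)
  · exact hsat f g hf hg f0 g0 u v (fun i => congrArg Prod.fst (huv i)) hu.1
  · exact ksat f g hf hg f0 g0 u v (fun i => congrArg Prod.snd (huv i)) hu.2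

theorem union {Γ : Type*} {L M : Set (ℕ → Γ)} (hL : Recognizable L) (hM : Recognizable M) :
    Recognizable (L ∪ M) := by
  have := (hL.compl.inter hM.compl).compl
  rwa [← Set.compl_union, compl_compl] at this

theorem comap {Γ Δ : Type*} {L : Set (ℕ → Δ)} (hL : Recognizable L) (t : Γ → Δ) :
    Recognizable {u : ℕ → Γ | (fun n => t (u n)) ∈ L} := by
  obtain ⟨S, hS, h, hloc, hsat⟩ := hL
  exact ⟨S, hS, fun n u => h n fun k => t (u k),
    fun n u v huv => hloc _ _ _ fun k hk => congrArg t (huv k hk),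
    fun f g hf hg f0 g0 u v huv hu => hsat f g hf hg f0 g0 _ _ huv hu⟩

/-- Projection of recognizable sets, by means of the power set of the set of colours. -/
theorem proj {Γ Δ B : Type*} {L : Set (ℕ → Δ)} (hL : Recognizable L) (t : Γ → B → Δ) :
    Recognizable {u : ℕ → Γ | ∃ b : ℕ → B, (fun n => t (u n) (b n)) ∈ L} := by
  obtain ⟨S, hS, h, hloc, hsat⟩ := hL
  refine ⟨Set S, inferInstance, fun n u => {s | ∃ b : ℕ → B, h n (fun k => t (u k) (b k)) = s},
    fun n u v huv => ?_, fun f g hf hg f0 g0 u v huv hu => ?_⟩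
  · ext s
    refine exists_congr fun b => ?_
    rw [hloc n _ (fun k => t (v k) (b k)) fun k hk => by rw [huv k hk]]
  · obtain ⟨b, hb⟩ := hu
    -- Equal sets of colours: each factor of `v` has a labelling with the colour that `b` gives to
    -- the matching factor of `u`.
    have key : ∀ i, ∃ c : ℕ → B, h (g (i + 1) - g i) (fun k => t (v (g i + k)) (c k)) =
        h (f (i + 1) - f i) (fun k => t (u (f i + k)) (b (f i + k))) := fun i =>
      (Set.ext_iff.1 (huv i) _).1 ⟨fun k => b (f i + k), rfl⟩
    choose c hc using key
    obtain ⟨d, hd⟩ := hg.exists_glue g0 c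
    refine ⟨d, hsat f g hf hg f0 g0 _ _ (fun i => ?_) hb⟩
    rw [← hc i]
    exact hloc _ _ _ fun k hk => by rw [hd i k hk]

/-! ### Basic recognizable sets and Büchi automata -/

/-- Some letter belongs to `F`. -/
theorem exists_mem {Γ : Type*} (F : Set Γ) : Recognizable {u : ℕ → Γ | ∃ n, u n ∈ F} := by
  refine ⟨Prop, inferInstance, fun n u => ∃ k < n, u k ∈ F, fun n u v huv => ?_,
    fun f g hf hg f0 g0 u v huv hu => ?_⟩
  · exact propext (exists_congr fun k => and_congr_right fun hk => by rw [huv k hk])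
  · obtain ⟨n, hn⟩ := hu
    obtain ⟨i, k, hk, rfl⟩ := hf.exists_factor f0 n
    obtain ⟨l, -, hl⟩ := (huv i).mp ⟨k, hk, hn⟩
    exact ⟨_, hl⟩

/-- Infinitely many letters belong to `F`. -/
theorem infinite_mem {Γ : Type*} (F : Set Γ) :
    Recognizable {u : ℕ → Γ | {n | u n ∈ F}.Infinite} := by
  refine ⟨Prop, inferInstance, fun n u => ∃ k < n, u k ∈ F, fun n u v huv => ?_,
    fun f g hf hg f0 g0 u v huv hu => ?_⟩
  · exact propext (exists_congr fun k => and_congr_right fun hk => by rw [huv k hk])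
  · refine Set.infinite_of_not_bddAbove ?_
    rintro ⟨N, hN⟩
    obtain ⟨n, hn, hlt⟩ := hu.exists_gt (f (N + 1))
    obtain ⟨i, k, hk, rfl⟩ := hf.exists_factor f0 n
    obtain ⟨l, -, hl⟩ := (huv i).mp ⟨k, hk, hn⟩
    -- The `i`-th factor reaches beyond `f (N + 1)`, so `i > N`, and `i ≤ g i` then contradicts the
    -- bound.
    have h1 : g i + l ≤ N := hN hl
    have h2 : i ≤ g i := hg.id_le i
    have h3 := hf.monotone (show i + 1 ≤ N + 1 by omega)
    omega

/-- The first letter belongs to `F`. -/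
theorem zero_mem {Γ : Type*} (F : Set Γ) : Recognizable {u : ℕ → Γ | u 0 ∈ F} := by
  -- The guard `0 < n` keeps the colour of the empty word independent of `u 0`.
  refine ⟨Prop, inferInstance, fun n u => 0 < n ∧ u 0 ∈ F, fun n u v huv => ?_,
    fun f g hf hg f0 g0 u v huv hu => ?_⟩
  · exact propext (and_congr_right fun hn => by rw [huv 0 hn])
  · have h1 := hf (Nat.zero_lt_one)
    have h2 := ((huv 0).mp ⟨by simpa [f0] using h1, by simpa [f0] using hu⟩).2
    simpa [g0] using h2

/-- Some letter of `F` is followed, later, by a letter of `G`. -/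
theorem exists_lt_mem {Γ : Type*} (F G : Set Γ) :
    Recognizable {u : ℕ → Γ | ∃ m n, m < n ∧ u m ∈ F ∧ u n ∈ G} := by
  refine ⟨Prop × Prop × Prop, inferInstance, fun n u => (∃ k < n, u k ∈ F, ∃ k < n, u k ∈ G,
    ∃ k < n, ∃ l < n, k < l ∧ u k ∈ F ∧ u l ∈ G), fun n u v huv => ?_,
    fun f g hf hg f0 g0 u v huv hu => ?_⟩
  · refine Prod.ext (propext ?_) (Prod.ext (propext ?_) (propext ?_))
    · exact exists_congr fun k => and_congr_right fun hk => by rw [huv k hk]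
    · exact exists_congr fun k => and_congr_right fun hk => by rw [huv k hk]
    · exact exists_congr fun k => and_congr_right fun hk => exists_congr fun l =>
        and_congr_right fun hl => by rw [huv k hk, huv l hl]
  · obtain ⟨m, n, hmn, hm, hn⟩ := hu
    obtain ⟨i, k, hk, rfl⟩ := hf.exists_factor f0 m
    obtain ⟨j, l, hl, rfl⟩ := hf.exists_factor f0 n
    rcases lt_trichotomy i j with hij | rfl | hij
    · obtain ⟨k', hk', hF⟩ := (congrArg Prod.fst (huv i)).mp ⟨k, hk, hm⟩
      obtain ⟨l', hl', hG⟩ := (congrArg (fun s => s.2.1) (huv j)).mp ⟨l, hl, hn⟩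
      have := hg.monotone (show i + 1 ≤ j from hij)
      exact ⟨_, _, by omega, hF, hG⟩
    · obtain ⟨k', hk', l', hl', hkl, hF, hG⟩ :=
        (congrArg (fun s => s.2.2) (huv i)).mp ⟨k, hk, l, hl, by omega, hm, hn⟩
      exact ⟨_, _, by omega, hF, hG⟩
    · have := hf.monotone (show j + 1 ≤ i from hij)
      omega

/-- Some two consecutive letters are related by `r`. -/
theorem exists_succ {Γ : Type*} [Finite Γ] (r : Γ → Γ → Prop) :
    Recognizable {u : ℕ → Γ | ∃ n, r (u n) (u (n + 1))} := by
  -- Colours must live in `Type`, so letters are numbered. The colour records the first letter, the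
  -- last letter, and whether a related pair lies inside.
  obtain ⟨N, ⟨e⟩⟩ := Finite.exists_equiv_fin Γ
  refine ⟨Option (Fin N) × Option (Fin N) × Prop, inferInstance, fun n u =>
    (if 0 < n then some (e (u 0)) else none, if 0 < n then some (e (u (n - 1))) else none,
      ∃ k, k + 1 < n ∧ r (u k) (u (k + 1))), fun n u v huv => ?_,
    fun f g hf hg f0 g0 u v huv hu => ?_⟩
  · refine Prod.ext ?_ (Prod.ext ?_ (propext ?_))
    · dsimp only
      split_ifs with hn
      · rw [huv 0 hn]
      · rfl
    · dsimp only
      split_ifs with hn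
      · rw [huv (n - 1) (by omega)]
      · rfl
    · exact exists_congr fun k => and_congr_right fun hk => by
        rw [huv k (by omega), huv (k + 1) hk]
  · obtain ⟨n, hn⟩ := hu
    obtain ⟨i, k, hk, rfl⟩ := hf.exists_factor f0 n
    by_cases hk' : k + 1 < f (i + 1) - f i
    · obtain ⟨l, -, hl⟩ := (congrArg (fun s => s.2.2) (huv i)).mp ⟨k, hk', hn⟩
      exact ⟨_, hl⟩
    -- The pair straddles a border: the last letter of one factor and the first of the next, both
    -- recorded by the colours.
    · have hfi := hf (Nat.lt_succ_self i)
      have hgi := hg (Nat.lt_succ_self i)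
      have hfj := hf (Nat.lt_succ_self (i + 1))
      have hgj := hg (Nat.lt_succ_self (i + 1))
      simp only [Nat.succ_eq_add_one] at hfi hgi hfj hgj
      have h1 := congrArg (fun s => s.2.1) (huv i)
      have h2 := congrArg Prod.fst (huv (i + 1))
      dsimp only at h1 h2
      rw [if_pos (by omega), if_pos (by omega), Option.some_inj, e.apply_eq_iff_eq] at h1 h2
      rw [show f i + k + 1 = f (i + 1) + 0 by omega, h2,
        show f i + k = f i + (f (i + 1) - f i - 1) by omega, h1] at hn
      refine ⟨g i + (g (i + 1) - g i - 1), ?_⟩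
      rwa [show g i + (g (i + 1) - g i - 1) + 1 = g (i + 1) + 0 by omega]

/-- Büchi automata recognize recognizable sets. -/
theorem buchiAccepts {A σ : Type*} [Finite A] [Finite σ] (M : NFA A σ) :
    Recognizable M.buchiAccepts := by
  -- The run is a second track, to be projected away; start, transitions and acceptance are
  -- conditions on the pair of tracks.
  have h1 := zero_mem {s : A × σ | s.2 ∈ M.start}
  have h2 := (exists_succ fun s s' : A × σ => s'.2 ∉ M.step s.2 s.1).compl
  have h3 := infinite_mem {s : A × σ | s.2 ∈ M.accept}
  have h4 := (h1.inter (h2.inter h3)).proj (fun (a : A) (s : σ) => (a, s))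
  convert h4 using 1
  ext w
  refine exists_congr fun ρ => ?_
  simp

end Recognizable

theorem IsOmegaRegular.recognizable {A : Type*} [Finite A] {L : Set (ℕ → A)}
    (hL : IsOmegaRegular L) : Recognizable L := by
  obtain ⟨σ, hσ, M, rfl⟩ := hL
  exact Recognizable.buchiAccepts M

/-! ### From MSO formulae to recognizable sets -/

/-- The letters of the words that encode an infinite word together with the interpretations of
predicate symbols and variables. -/
abbrev MSOLetter (A : Type*) (ℓ p q : ℕ) : Type _ :=
  ((Fin ℓ → Prop) × A) × (Fin p → Prop) × (Fin q → Prop)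

/-- The word that encodes an infinite word together with the interpretations of predicate symbols
and variables. -/
def msoEncode {A : Type*} {ℓ p q : ℕ} (w : ℕ → A) (P : Fin ℓ → Set ℕ) (xs : Fin p → ℕ)
    (Xs : Fin q → Set ℕ) (n : ℕ) : MSOLetter A ℓ p q :=
  ((fun i => n ∈ P i, w n), fun i => n = xs i, fun j => n ∈ Xs j)

theorem msoEncode_cons_left {A : Type*} {ℓ p q : ℕ} (w : ℕ → A) (P : Fin ℓ → Set ℕ)
    (xs : Fin p → ℕ) (Xs : Fin q → Set ℕ) (m n : ℕ) :
    msoEncode w P (Fin.cons m xs : Fin (p + 1) → ℕ) Xs n =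
      ((msoEncode w P xs Xs n).1, Fin.cons (n = m) (msoEncode w P xs Xs n).2.1,
        (msoEncode w P xs Xs n).2.2) := by
  refine Prod.ext rfl (Prod.ext (funext fun i => ?_) rfl)
  refine Fin.cases ?_ (fun i => ?_) i <;> rfl

theorem msoEncode_cons_right {A : Type*} {ℓ p q : ℕ} (w : ℕ → A) (P : Fin ℓ → Set ℕ)
    (xs : Fin p → ℕ) (Xs : Fin q → Set ℕ) (T : Set ℕ) (n : ℕ) :
    msoEncode w P xs (Fin.cons T Xs : Fin (q + 1) → Set ℕ) n =
      ((msoEncode w P xs Xs n).1, (msoEncode w P xs Xs n).2.1,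
        Fin.cons (n ∈ T) (msoEncode w P xs Xs n).2.2) := by
  refine Prod.ext rfl (Prod.ext rfl (funext fun i => ?_))
  refine Fin.cases ?_ (fun i => ?_) i <;> rfl

/-- MSO formulae define recognizable sets. -/
theorem MSOFormula.exists_recognizable {A : Type*} {ℓ p q : ℕ} (φ : MSOFormula A ℓ p q) :
    ∃ R : Set (ℕ → MSOLetter A ℓ p q), Recognizable R ∧ ∀ w P xs Xs,
      msoEncode w P xs Xs ∈ R ↔ φ.Holds w P xs Xs := by
  induction φ with
  | letter a x =>
    refine ⟨_, Recognizable.exists_mem {s | s.2.1 x ∧ s.1.2 = a}, fun w P xs Xs => ?_⟩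
    simp [msoEncode, MSOFormula.Holds]
  | le x y =>
    refine ⟨_, (Recognizable.exists_lt_mem {s | s.2.1 y} {s | s.2.1 x}).compl,
      fun w P xs Xs => ?_⟩
    simp [msoEncode, MSOFormula.Holds]
  | pred i x =>
    refine ⟨_, Recognizable.exists_mem {s | s.2.1 x ∧ s.1.1 i}, fun w P xs Xs => ?_⟩
    simp [msoEncode, MSOFormula.Holds]
  | mem x X =>
    refine ⟨_, Recognizable.exists_mem {s | s.2.1 x ∧ s.2.2 X}, fun w P xs Xs => ?_⟩
    simp [msoEncode, MSOFormula.Holds]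
  | and φ ψ ihφ ihψ =>
    obtain ⟨R, hR, hRφ⟩ := ihφ
    obtain ⟨T, hT, hTψ⟩ := ihψ
    exact ⟨_, hR.inter hT, fun w P xs Xs => and_congr (hRφ w P xs Xs) (hTψ w P xs Xs)⟩
  | not φ ih =>
    obtain ⟨R, hR, hRφ⟩ := ih
    exact ⟨_, hR.compl, fun w P xs Xs => not_congr (hRφ w P xs Xs)⟩
  | exFO φ ih =>
    obtain ⟨R, hR, hRφ⟩ := ih
    -- Projection guesses an arbitrary set `b`; the two extra conditions, nonempty and without two
    -- distinct elements, make it a singleton.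
    refine ⟨_, (hR.inter ((Recognizable.exists_mem {s | s.2.1 0}).inter
      (Recognizable.exists_lt_mem {s | s.2.1 0} {s | s.2.1 0}).compl)).proj
        (fun s b => (s.1, Fin.cons b s.2.1, s.2.2)), fun w P xs Xs => ?_⟩
    constructor
    · rintro ⟨b, hb, ⟨m, hm⟩, hlt⟩
      have hm' : b m := hm
      have hbm : ∀ n, b n = (n = m) := fun n => propext ⟨fun hn => by
        rcases lt_trichotomy n m with h | h | h
        · exact absurd ⟨n, m, h, hn, hm⟩ hlt
        · exact h
        · exact absurd ⟨m, n, h, hm, hn⟩ hlt, fun h => h ▸ hm'⟩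
      refine ⟨m, (hRφ w P (Fin.cons m xs) Xs).1 ?_⟩
      rw [funext (msoEncode_cons_left w P xs Xs m)]
      simpa only [hbm] using hb
    · rintro ⟨m, hm⟩
      refine ⟨fun n => n = m, ?_, ⟨m, rfl⟩, ?_⟩
      · have := (hRφ w P (Fin.cons m xs) Xs).2 hm
        rwa [funext (msoEncode_cons_left w P xs Xs m)] at this
      · rintro ⟨i, j, hij, hi, hj⟩
        exact hij.ne (Eq.trans (show i = m from hi) (show j = m from hj).symm)
  | exSO φ ih =>
    obtain ⟨R, hR, hRφ⟩ := ih
    refine ⟨_, hR.proj (fun s b => (s.1, s.2.1, Fin.cons b s.2.2)), fun w P xs Xs => ?_⟩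
    refine exists_congr fun T => ?_
    rw [← hRφ w P xs (Fin.cons T Xs), funext (msoEncode_cons_right w P xs Xs T)]
    rfl

/-! ### Ramsey's theorem and ultimately periodic words -/

/-- The additive form of Ramsey's theorem for pairs: a finite colouring of pairs of natural numbers
is constant on the consecutive pairs of some increasing sequence. -/
theorem exists_strictMono_monochromatic {S : Type*} [Finite S] (c : ℕ → ℕ → S) :
    ∃ (t : ℕ → ℕ) (e : S), StrictMono t ∧ ∀ i, c (t i) (t (i + 1)) = e := by
  -- A finite colouring is constant on a set of a nonprincipal ultrafilter.
  have pigeon : ∀ d : ℕ → S, ∃ s, ∀ᶠ j in (Filter.hyperfilter ℕ : Filter ℕ), d j = s := by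
    intro d
    by_contra hno
    have h1 : ∀ᶠ j in (Filter.hyperfilter ℕ : Filter ℕ), ∀ s, d j ≠ s :=
      Filter.eventually_all.2 fun s => Ultrafilter.eventually_not.2 (not_exists.1 hno s)
    obtain ⟨j, hj⟩ := h1.exists
    exact hj _ rfl
  choose d hd using fun i => pigeon (c i)
  obtain ⟨e, he⟩ := pigeon d
  -- Choose `t` greedily among the `i` with `d i = e`: each new index satisfies finitely many
  -- conditions that hold ultrafilter-often.
  obtain ⟨t, ht, hr⟩ := exists_seq_of_forall_finset_exists (fun i => d i = e)
    (fun i j => i < j ∧ c i j = e) (fun s hs => by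
      have h1 : ∀ᶠ j in (Filter.hyperfilter ℕ : Filter ℕ), ∀ i ∈ s, i < j ∧ c i j = e := by
        rw [Filter.eventually_all_finset]
        intro i hi
        have h2 : ∀ᶠ j in (Filter.hyperfilter ℕ : Filter ℕ), i < j :=
          Nat.hyperfilter_le_atTop (Filter.eventually_gt_atTop i)
        filter_upwards [h2, hd i] with j hj hc
        exact ⟨hj, hc.trans (hs i hi)⟩
      exact (he.and h1).exists)
  exact ⟨t, e, strictMono_nat_of_lt_succ fun n => (hr n (n + 1) n.lt_succ_self).1,
    fun i => (hr i (i + 1) i.lt_succ_self).2⟩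

/-- A nonempty recognizable set contains an ultimately periodic word. -/
theorem Recognizable.exists_ultimately_periodic {Γ : Type*} {L : Set (ℕ → Γ)}
    (hL : Recognizable L) (hne : L.Nonempty) :
    ∃ v ∈ L, ∃ N p, 0 < p ∧ ∀ n, N ≤ n → v (n + p) = v n := by
  obtain ⟨S, hS, h, hloc, hsat⟩ := hL
  obtain ⟨u, hu⟩ := hne
  obtain ⟨t, e, ht, hc⟩ := exists_strictMono_monochromatic
    fun i j => h (j - i) fun k => u (i + k)
  have h01 : t 0 < t 1 := ht Nat.zero_lt_one
  have h12 : t 1 < t 2 := ht Nat.one_lt_two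
  obtain ⟨p, hp⟩ : ∃ p, p = t 2 - t 1 := ⟨_, rfl⟩
  have hp0 : 0 < p := by omega
  -- Keep `u` before `t 1`, then repeat its factor from `t 1` to `t 2`; every later factor of `u`
  -- has the same colour `e`. Starting at `t 1` makes the first factor nonempty even if `t 0 = 0`.
  refine ⟨fun n => if n < t 1 then u n else u (t 1 + (n - t 1) % p), ?_, t 1, p, hp0,
    fun n hn => ?_⟩
  · refine hsat (fun i => if i = 0 then 0 else t i)
      (fun i => if i = 0 then 0 else t 1 + (i - 1) * p)
      (strictMono_nat_of_lt_succ fun i => ?_) (strictMono_nat_of_lt_succ fun i => ?_) rfl rfl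
      u _ (fun i => ?_) hu
    · rcases i with _ | i
      · simp only [if_true, zero_add, one_ne_zero, if_false]
        omega
      · simpa using ht (Nat.lt_succ_self (i + 1))
    · rcases i with _ | i
      · simp only [if_true, zero_add, one_ne_zero, if_false]
        omega
      · simp only [Nat.succ_ne_zero, if_false, Nat.add_sub_cancel, add_mul]
        omega
    · rcases i with _ | i
      · simp only [if_true, zero_add, one_ne_zero, if_false, Nat.sub_self, zero_mul, add_zero,
          Nat.sub_zero]
        exact hloc _ _ _ fun k hk => by rw [if_pos hk]
      · simp only [Nat.succ_ne_zero, if_false, Nat.add_sub_cancel]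
        rw [hc (i + 1), ← hc 1, ← hp, show t 1 + (i + 1) * p - (t 1 + i * p) = p by
          rw [add_mul]; omega]
        refine hloc _ _ _ fun k hk => ?_
        rw [if_neg (by omega), show t 1 + i * p + k - t 1 = k + p * i by
          rw [mul_comm p]; omega, Nat.add_mul_mod_self_left, Nat.mod_eq_of_lt hk]
  · dsimp only
    rw [if_neg (by omega), if_neg (by omega), show n + p - t 1 = n - t 1 + p by omega,
      Nat.add_mod_right]

/-! ### Regularity of ultimately periodic predicates -/

/-- Ultimately periodic uniform predicates are regular. -/
theorem MonadicPredicate.isRegular_ofUniform {Q : Set ℕ} {N p : ℕ} (hp : 0 < p)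
    (hQ : ∀ n, N ≤ n → (n + p ∈ Q ↔ n ∈ Q)) : (MonadicPredicate.ofUniform Q).IsRegular := by
  -- `D n` consists of the finite windows of `Q` starting at `n`. The left quotient by `x` is `D
  -- x.length` if `x` is a prefix of `Q`, and empty otherwise; periodicity leaves finitely many.
  set D : ℕ → Language Bool := fun n =>
    {u | ∀ (i : ℕ) (hi : i < u.length), u[i] = true ↔ n + i ∈ Q} with hD
  have hper : ∀ n, N ≤ n → D (n + p) = D n := by
    intro n hn
    ext u
    refine forall_congr' fun i => forall_congr' fun hi => iff_congr Iff.rfl ?_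
    rw [show n + p + i = n + i + p by omega]
    exact hQ _ (by omega)
  have hred : ∀ n, D n ∈ D '' Set.Iio (N + p) := by
    intro n
    induction n using Nat.strong_induction_on with
    | _ n ih =>
      by_cases hn : n < N + p
      · exact ⟨n, hn, rfl⟩
      · have h1 := ih (n - p) (by omega)
        rwa [← hper (n - p) (by omega), Nat.sub_add_cancel (by omega)] at h1
  have hmem : ∀ u, u ∈ (MonadicPredicate.ofUniform Q).language ↔ u ∈ D 0 := by
    intro u
    constructor
    · intro h i hi
      exact h ⟨i, hi⟩ |>.trans (by rw [zero_add]; rfl)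
    · intro h i
      exact (h i i.2).trans (by rw [zero_add]; rfl)
  unfold MonadicPredicate.IsRegular
  rw [Language.isRegular_iff_finite_range_leftQuotient]
  refine (((Set.finite_Iio (N + p)).image D).insert (0 : Language Bool)).subset ?_
  rintro _ ⟨x, rfl⟩
  by_cases hx : x ∈ D 0
  · right
    convert hred x.length using 1
    ext y
    rw [Language.mem_leftQuotient, hmem]
    constructor
    · intro h i hi
      have := h (x.length + i) (by simp; omega)
      simpa using this
    · intro h i hi
      rw [List.length_append] at hi
      rcases lt_or_ge i x.length with hix | hix
      · rw [List.getElem_append_left hix]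
        exact hx i hix
      · rw [List.getElem_append_right hix, h (i - x.length) (by omega),
          Nat.add_sub_cancel' hix, zero_add]
  · left
    ext y
    rw [Language.mem_leftQuotient, hmem]
    refine iff_of_false (fun h => hx fun i hi => ?_) (Language.notMem_zero y)
    have := h i (by simp; omega)
    rwa [List.getElem_append_left hi] at this

/-! ### The set of admissible predicate tuples -/

theorem mainTheorem8 {A : Type*} [Finite A] {ℓ : ℕ} (φ : MSOSentence A ℓ) (P : Fin ℓ → Set ℕ)
    (hL : IsOmegaRegular (φ.omegaLanguage P)) :
    ∃ Q : Fin ℓ → Set ℕ, (∀ i, (MonadicPredicate.ofUniform (Q i)).IsRegular) ∧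
      φ.omegaLanguage P = φ.omegaLanguage Q := by
  obtain ⟨R, hR, hRφ⟩ := MSOFormula.exists_recognizable φ
  have hM := hL.recognizable.comap (fun s : MSOLetter A ℓ 0 0 => s.1.2)
  set M : Set (ℕ → MSOLetter A ℓ 0 0) := {u | (fun n => (u n).1.2) ∈ φ.omegaLanguage P}
  -- No input word separates the two languages: a universal quantifier over words, as complement,
  -- projection, complement.
  have hK := (((hM.inter hR.compl).union (hR.inter hM.compl)).proj
    (fun (P : Fin ℓ → Prop) (a : A) => (((P, a), Fin.elim0, Fin.elim0) : MSOLetter A ℓ 0 0))).compl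
  have key : ∀ v : ℕ → Fin ℓ → Prop, v ∈ {u | ∃ b : ℕ → A, (fun n =>
      (((u n, b n), Fin.elim0, Fin.elim0) : MSOLetter A ℓ 0 0)) ∈ M ∩ Rᶜ ∪ R ∩ Mᶜ}ᶜ ↔
      φ.omegaLanguage P = φ.omegaLanguage fun i => {n | v n i} := by
    intro v
    rw [Set.mem_compl_iff, Set.mem_ofPred_eq, not_exists, Set.ext_iff]
    refine forall_congr' fun w => ?_
    have h1 : (fun n => (((v n, w n), Fin.elim0, Fin.elim0) : MSOLetter A ℓ 0 0)) =
        msoEncode w (fun i => {n | v n i}) Fin.elim0 Fin.elim0 :=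
      funext fun n => Prod.ext rfl (Prod.ext (Subsingleton.elim _ _) (Subsingleton.elim _ _))
    have h2 : (fun n => (((v n, w n), Fin.elim0, Fin.elim0) : MSOLetter A ℓ 0 0)) ∈ R ↔
        w ∈ φ.omegaLanguage fun i => {n | v n i} := by
      rw [h1]
      exact hRφ _ _ _ _
    have h3 : (fun n => (((v n, w n), Fin.elim0, Fin.elim0) : MSOLetter A ℓ 0 0)) ∈ M ↔
        w ∈ φ.omegaLanguage P := Iff.rfl
    rw [Set.mem_union, Set.mem_inter_iff, Set.mem_inter_iff, Set.mem_compl_iff, Set.mem_compl_iff,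
      h2, h3]
    tauto
  obtain ⟨v, hv, N, p, hp, hper⟩ := hK.exists_ultimately_periodic
    ⟨fun n i => n ∈ P i, (key _).2 rfl⟩
  exact ⟨fun i => {n | v n i}, fun i => MonadicPredicate.isRegular_ofUniform hp fun n hn =>
    iff_of_eq (congrFun (hper n hn) i), (key v).1 hv⟩
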